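/- Let $d\ge 1$ and $p>1$, and order $\mathbb R_+^d=[0,\infty)^d$ coordinatewise. Let $(\mathcal F_t)_{t\in\mathbb R_+^d}$ be a filtration on a probability space $(\Omega,\mathcal F,\mathbb P)$ (that is, sub-$\sigma$-fields of $\mathcal F$ with $\mathcal F_s\subseteq\mathcal F_t$ for $s\le t$) that is commuting: for all $s,t\in\mathbb R_+^d$ and every bounded real $\mathcal F_t$-measurable random variable $Y$, $\mathbb E(Y\mid\mathcal F_s)=\mathbb E(Y\mid\mathcal F_{s\wedge t})$ a.s., where $(s\wedge t)_i=\min(s_i,t_i)$. Let $M=(M_t)_{t\in\mathbb R_+^d}$ be a real-valued multiparameter martingale with respect to $(\mathcal F_t)$, i.e. $M$ is adapted and integrable and $\mathbb E(M_t\mid\mathcal F_s)=M_s$ a.s. for all $s\le t$. Assume that the sample paths of $M$ are almost surely lamp, where $f:\mathbb R_+^d\to\mathbb R$ is called lamp if (i) for every $t\in\mathbb R_+^d$ and each of the $2^d$ relations $\mathcal R=(\mathcal R_1,\dots,\mathcal R_d)$ with $\mathcal R_i\in\{\le,>\}$, the limit of $f(u)$ as $u\to t$ with $t_i\,\mathcal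 R_i\,u_i$ for all $i$ exists in $\mathbb R$ (no condition if there is no such $u\in\mathbb R_+^d$); (ii) for $\mathcal R=(\le,\dots,\le)$ this limit equals $f(t)$; (iii) $f(t)=0$ whenever some $t_i=0$. Assume finally that there is a constant $c\ge 0$ such that for all $t\in\mathbb R_+^d$, $$\mathbb E\left(|M_t|^p\right)=\left(c\,\mathrm{Leb}_d([0,t])\right)^{p/2}.$$ Then, for almost every $\omega\in\Omega$, the path $t\mapsto M_t(\omega)$ is slowly growing, i.e. $\sup_{t\in\mathbb R_+^d}|M_t(\omega)|(1+|t|)^{-\alpha}<\infty$ for some $\alpha\ge 0$ (with $|t|$ the Euclidean norm), and $M(\omega)$ is a tempered distribution: for every real-valued Schwartz function $\varphi\in\mathcal S(\mathbb R^d)$ the integral $\int_{\mathbb R_+^d}M_t(\omega)\varphi(t)\,dt$ converges absolutely, and $\varphi\mapsto\int_{\mathbb R_+^d}M_t(\omega)\varphi(t)\,dt$ is a continuous linear functional on $\mathcal S(\mathbb R^d)$. -/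

import Mathlib

open MeasureTheory Filter Topology
open scoped NNReal ENNReal SchwartzMap

noncomputable section

namespace MultiparameterField

/-- The point `t ∈ ℝ₊ᵈ` seen in `ℝᵈ` with its Euclidean norm. -/
def toEuclidean {d : ℕ} (t : Fin d → ℝ≥0) : EuclideanSpace ℝ (Fin d) :=
  WithLp.toLp 2 (fun i => (t i : ℝ))

/-- The set `{u ∈ ℝ₊ᵈ | t 𝓡 u}`, where the `i`-th component of the relation `𝓡` is `≤` if `R i`
is `true` and `>` if `R i` is `false`. -/
def quadrant {d : ℕ} (R : Fin d → Bool) (t : Fin d → ℝ≥0) : Set (Fin d → ℝ≥0) :=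
  {u | ∀ i, if R i = true then t i ≤ u i else t i > u i}

/-- A function on `ℝ₊ᵈ` is lamp ("limits along monotone paths"). -/
structure IsLamp {d : ℕ} (f : (Fin d → ℝ≥0) → ℝ) : Prop where
  exists_limit : ∀ (R : Fin d → Bool) (t : Fin d → ℝ≥0),
    ∃ l : ℝ, Tendsto f (𝓝[quadrant R t] t) (𝓝 l)
  right_continuous : ∀ t : Fin d → ℝ≥0,
    Tendsto f (𝓝[quadrant (fun _ => true) t] t) (𝓝 (f t))
  zero_on_axes : ∀ t : Fin d → ℝ≥0, (∃ i, t i = 0) → f t = 0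

/-- A filtration indexed by `ℝ₊ᵈ` is commuting: for all `s, t` and every bounded
`ℱ t`-measurable `Y`, `E[Y | ℱ s] = E[Y | ℱ (s ∧ t)]` almost surely
(`s ⊓ t` is the coordinatewise minimum). -/
def IsCommuting {Ω : Type*} {m : MeasurableSpace Ω} {d : ℕ}
    (ℱ : Filtration (Fin d → ℝ≥0) m) (P : Measure Ω) : Prop :=
  ∀ (s t : Fin d → ℝ≥0) (Y : Ω → ℝ), Measurable[ℱ t] Y → (∃ C : ℝ, ∀ ω, |Y ω| ≤ C) →
    P[Y | ℱ s] =ᵐ[P] P[Y | ℱ (s ⊓ t)]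

/-- The Lebesgue measure of the box `[0, t] ⊆ ℝᵈ`. -/
def lebBox {d : ℕ} (t : Fin d → ℝ≥0) : ℝ :=
  (volume (Set.Icc (0 : Fin d → ℝ) (fun i => (t i : ℝ)))).toReal

/-- A function on `ℝ₊ᵈ` is slowly growing (polynomially bounded). -/
def IsSlowlyGrowing {d : ℕ} (f : (Fin d → ℝ≥0) → ℝ) : Prop :=
  ∃ α : ℝ, 0 ≤ α ∧ ∃ C : ℝ, ∀ t, |f t| ≤ C * (1 + ‖toEuclidean t‖) ^ α

/-- The function `f` on `ℝ₊ᵈ` is a tempered distribution on `ℝᵈ` : for every real-valued Schwartz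
function `φ` the integral `∫_{ℝ₊ᵈ} f(t) φ(t) dt` converges absolutely, and it is a continuous
linear functional of `φ ∈ 𝓢(ℝᵈ)`. -/
def IsTempered {d : ℕ} (f : (Fin d → ℝ≥0) → ℝ) : Prop :=
  (∀ φ : 𝓢(EuclideanSpace ℝ (Fin d), ℝ),
    IntegrableOn (fun x : EuclideanSpace ℝ (Fin d) => f (fun i => (x i).toNNReal) * φ x)
      {x | ∀ i, 0 ≤ x i}) ∧
  ∃ u : 𝓢(EuclideanSpace ℝ (Fin d), ℝ) →L[ℝ] ℝ, ∀ φ : 𝓢(EuclideanSpace ℝ (Fin d), ℝ),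
    u φ = ∫ x in {x : EuclideanSpace ℝ (Fin d) | ∀ i, 0 ≤ x i},
      f (fun i => (x i).toNNReal) * φ x

end MultiparameterField

end

/-!
Almost all paths of the martingale grow at most polynomially because their maxima over boxes are
controlled by a moment at the upper corner (Cairoli's inequality), and a measurable function of
polynomial growth is a tempered distribution.

*Maximal inequality.* Commutation upgrades the martingale property to
`P[M t | ℱ s] = M (s ⊓ t)` for all `s, t` (`condExp_ae_eq_inf`). The values of `M` with `i`-th
coordinate `r` are therefore conditional expectations, given a `σ`-field depending on `r` only, of
the values with `i`-th coordinate at the horizon. So Doob's one-parameter `L^p` inequality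
(`lintegral_sup_condExp_rpow_le`) can be applied to one coordinate after the other
(`lintegral_gridSup_insert_le`), which bounds the `p`-th moment of the maximum of `|M|` over any
finite grid in `[0, N]ᵈ` by a constant times that of `M` at `(N, …, N)` (`lintegral_gridSup_le`).
The constant does not depend on the grid; right continuity of lamp paths and Fatou's lemma pass to
the whole box.

*Growth.* The moment at the corner is a power of `N`. Dividing by a larger power makes the series of
expectations converge, hence almost surely `|M t| ^ p ≤ C (N + 1) ^ b` for all `N` and all
`t ∈ [0, N + 1]ᵈ` (`ae_isSlowlyGrowing`).

*Temperedness.* A lamp path is measurable as the limit of its discretizations from above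
(`IsLamp.measurable`), so polynomial growth suffices (`IsSlowlyGrowing.isTempered`).
-/

namespace MultiparameterField

/-! ### Doob's inequality for one-parameter martingales -/

/-- A weak maximal inequality for the martingale `k ↦ P[X | 𝒢 k]`, where the right-hand side only
sees the part of `X` above the level `a`. -/
theorem ofReal_mul_measure_le_setLIntegral {Ω : Type*} {m : MeasurableSpace Ω} {P : Measure Ω}
    [IsProbabilityMeasure P] (𝒢 : Filtration ℕ m) {X : Ω → ℝ} (hX : Integrable X P)
    (hX0 : 0 ≤ X) (hXm : Measurable X) (n : ℕ) {a : ℝ} (ha : 0 < a) :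
    ENNReal.ofReal a * P {ω | 2 * a ≤
      (Finset.range (n + 1)).sup' Finset.nonempty_range_add_one fun k => (P[X | 𝒢 k]) ω} ≤
    ∫⁻ ω in {ω | a ≤ X ω}, ENNReal.ofReal (X ω) ∂P := by
  -- Since `X ≤ Z + a`, the running maximum of `P[Z | 𝒢 k]` is at least `a` wherever that of
  -- `P[X | 𝒢 k]` is at least `2 * a`; and `Z` vanishes where `X < a`.
  set Z : Ω → ℝ := fun ω => max (X ω - a) 0 with hZ
  have hZi : Integrable Z P := (hX.sub (integrable_const a)).pos_part
  have hZ0 : 0 ≤ Z := fun ω => le_max_right _ _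
  have hsub : Submartingale (fun k => (P[Z | 𝒢 k])⁺) 𝒢 P :=
    (martingale_condExp Z 𝒢 P).submartingale.pos
  have key := maximal_ineq hsub (fun k ω => posPart_nonneg _) (ε := ⟨a, ha.le⟩) n
  have hle : ∀ᵐ ω ∂P, ∀ k, (P[X | 𝒢 k]) ω ≤ (P[Z | 𝒢 k]) ω + a := by
    rw [ae_all_iff]
    intro k
    have h1 : P[X | 𝒢 k] ≤ᵐ[P] P[Z + fun _ => a | 𝒢 k] := by
      refine condExp_mono hX (hZi.add (integrable_const a)) (.of_forall fun ω => ?_)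
      have := le_max_left (X ω - a) 0
      simp only [Pi.add_apply, hZ]
      linarith
    have h2 := condExp_add hZi (integrable_const (μ := P) a) (𝒢 k)
    filter_upwards [h1, h2] with ω h1 h2
    rw [h2] at h1
    simpa [condExp_const (𝒢.le k)] using h1
  have hmeas : P {ω | 2 * a ≤
      (Finset.range (n + 1)).sup' Finset.nonempty_range_add_one fun k => (P[X | 𝒢 k]) ω} ≤
      P {ω | a ≤ (Finset.range (n + 1)).sup' Finset.nonempty_range_add_one
        fun k => (P[Z | 𝒢 k])⁺ ω} := by
    refine measure_mono_ae ?_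
    filter_upwards [hle] with ω hω h
    change 2 * a ≤ _ at h
    change a ≤ _
    rw [Finset.le_sup'_iff] at h ⊢
    obtain ⟨k, hk, hk'⟩ := h
    refine ⟨k, hk, ?_⟩
    have := hω k
    have h3 : (P[Z | 𝒢 k]) ω ≤ (P[Z | 𝒢 k])⁺ ω := by
      rw [Pi.posPart_apply]; exact le_posPart _
    linarith
  have hint : ∫ ω in {ω | a ≤ (Finset.range (n + 1)).sup' Finset.nonempty_range_add_one
        fun k => (P[Z | 𝒢 k])⁺ ω}, (P[Z | 𝒢 n])⁺ ω ∂P ≤ ∫ ω, Z ω ∂P := by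
    refine (setIntegral_le_integral (hsub.integrable n)
      (.of_forall fun ω => posPart_nonneg _)).trans ?_
    rw [← integral_condExp (𝒢.le n) (f := Z)]
    refine le_of_eq (integral_congr_ae ?_)
    filter_upwards [condExp_nonneg (m := 𝒢 n) (.of_forall hZ0 : 0 ≤ᵐ[P] Z)] with ω hω
    rw [Pi.posPart_apply]
    exact posPart_of_nonneg hω
  calc _ ≤ ENNReal.ofReal a * P {ω | a ≤ (Finset.range (n + 1)).sup'
            Finset.nonempty_range_add_one fun k => (P[Z | 𝒢 k])⁺ ω} := by gcongr
    _ ≤ ENNReal.ofReal (∫ ω, Z ω ∂P) := by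
        refine le_trans (le_of_eq ?_) (key.trans (ENNReal.ofReal_le_ofReal hint))
        congr 1
        exact ENNReal.ofReal_eq_coe_nnreal ha.le
    _ = ∫⁻ ω, ENNReal.ofReal (Z ω) ∂P :=
        ofReal_integral_eq_lintegral_ofReal hZi (.of_forall hZ0)
    _ ≤ _ := by
        rw [← lintegral_indicator (measurableSet_le measurable_const hXm)]
        refine lintegral_mono fun ω => ?_
        by_cases h : a ≤ X ω
        · rw [Set.indicator_of_mem (show ω ∈ {ω | a ≤ X ω} from h)]
          exact ENNReal.ofReal_le_ofReal (max_le (by linarith) (hX0 ω))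
        · have : Z ω = 0 := max_eq_right (by linarith)
          simp [this]

/-- **Doob's `L^p` inequality** for the closed martingale `k ↦ P[X | 𝒢 k]`, with a constant that is
not optimal. -/
theorem lintegral_sup_condExp_rpow_le {Ω : Type*} {m : MeasurableSpace Ω} {P : Measure Ω}
    [IsProbabilityMeasure P] (𝒢 : Filtration ℕ m) {X : Ω → ℝ} (hX : Integrable X P)
    (hX0 : 0 ≤ X) (hXm : Measurable X) (n : ℕ) {p : ℝ} (hp : 1 < p) :
    ∫⁻ ω, ENNReal.ofReal (((Finset.range (n + 1)).sup' Finset.nonempty_range_add_one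
      fun k => (P[X | 𝒢 k]) ω) ^ p) ∂P ≤
    ENNReal.ofReal (p * 2 ^ p / (p - 1)) * ∫⁻ ω, ENNReal.ofReal (X ω ^ p) ∂P := by
  set S : Ω → ℝ := fun ω => (Finset.range (n + 1)).sup' Finset.nonempty_range_add_one
      fun k => (P[X | 𝒢 k]) ω with hS
  have hSm : Measurable S := by
    have := Finset.measurable_range_sup' (n := n) (f := fun k => P[X | 𝒢 k])
      (fun k _ => (stronglyMeasurable_condExp.mono (𝒢.le k)).measurable)
    convert this using 1
    ext ω
    simp [hS, Finset.sup'_apply]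
  have hS0 : 0 ≤ᵐ[P] S := by
    filter_upwards [condExp_nonneg (m := 𝒢 0) (.of_forall hX0 : 0 ≤ᵐ[P] X)] with ω hω
    exact le_trans hω (Finset.le_sup' (fun k => (P[X | 𝒢 k]) ω) (by simp))
  -- Weighting `P` by `X` turns the tail bound into a layer cake formula for `2 X`.
  set ν : Measure Ω := P.withDensity fun ω => ENNReal.ofReal (X ω) with hν
  have hp1 : 0 < p - 1 := by linarith
  have h1 := lintegral_rpow_eq_lintegral_meas_le_mul P hS0 hSm.aemeasurable (p := p) (by linarith)
  have h2 := lintegral_rpow_eq_lintegral_meas_le_mul ν (f := fun ω => 2 * X ω)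
    (.of_forall fun ω => mul_nonneg zero_le_two (hX0 ω)) (hXm.const_mul 2).aemeasurable hp1
  have h3 : ∫⁻ ω, ENNReal.ofReal ((2 * X ω) ^ (p - 1)) ∂ν =
      ENNReal.ofReal (2 ^ (p - 1)) * ∫⁻ ω, ENNReal.ofReal (X ω ^ p) ∂P := by
    rw [hν, lintegral_withDensity_eq_lintegral_mul _ (by fun_prop) (by fun_prop),
      ← lintegral_const_mul _ (by fun_prop)]
    refine lintegral_congr fun ω => ?_
    have hx := hX0 ω
    simp only [Pi.zero_apply] at hx
    simp only [Pi.mul_apply]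
    rw [← ENNReal.ofReal_mul hx, ← ENNReal.ofReal_mul (by positivity),
      Real.mul_rpow zero_le_two hx]
    congr 1
    rw [mul_left_comm]
    congr 1
    rcases hx.eq_or_lt with h | h
    · rw [← h, zero_mul, Real.zero_rpow (by linarith)]
    · rw [Real.rpow_sub_one h.ne']; field_simp
  have h4 : ∫⁻ t in Set.Ioi 0, P {ω | t ≤ S ω} * ENNReal.ofReal (t ^ (p - 1)) ≤
      2 * ∫⁻ t in Set.Ioi 0, ν {ω | t ≤ 2 * X ω} * ENNReal.ofReal (t ^ (p - 1 - 1)) := by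
    rw [← lintegral_const_mul' _ _ (by simp)]
    refine setLIntegral_mono' measurableSet_Ioi fun t (ht : 0 < t) => ?_
    have hw := ofReal_mul_measure_le_setLIntegral 𝒢 hX hX0 hXm n (half_pos ht)
    have hν' : ν {ω | t ≤ 2 * X ω} = ∫⁻ ω in {ω | t / 2 ≤ X ω}, ENNReal.ofReal (X ω) ∂P := by
      rw [hν, withDensity_apply _ (measurableSet_le measurable_const (hXm.const_mul 2))]
      congr 2
      ext ω
      simp only [Set.mem_ofPred_eq]
      constructor <;> intro h <;> linarith
    rw [mul_div_cancel₀ t two_ne_zero, ← hν'] at hw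
    calc P {ω | t ≤ S ω} * ENNReal.ofReal (t ^ (p - 1))
        = 2 * (ENNReal.ofReal (t / 2) * P {ω | t ≤ S ω} * ENNReal.ofReal (t ^ (p - 1 - 1))) := by
          have : ENNReal.ofReal (t ^ (p - 1)) =
              2 * (ENNReal.ofReal (t / 2) * ENNReal.ofReal (t ^ (p - 1 - 1))) := by
            rw [show (2 : ℝ≥0∞) = ENNReal.ofReal 2 by simp,
              ← ENNReal.ofReal_mul (by positivity), ← ENNReal.ofReal_mul (by positivity)]
            congr 1
            rw [Real.rpow_sub_one ht.ne' (p - 1)]; field_simp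
          rw [this]; ring
      _ ≤ _ := by gcongr
  rw [h3] at h2
  have h5 : ∫⁻ t in Set.Ioi 0, ν {ω | t ≤ 2 * X ω} * ENNReal.ofReal (t ^ (p - 1 - 1)) =
      ENNReal.ofReal (2 ^ (p - 1) / (p - 1)) * ∫⁻ ω, ENNReal.ofReal (X ω ^ p) ∂P := by
    rw [ENNReal.ofReal_div_of_pos hp1, ENNReal.mul_div_right_comm.symm, h2, mul_comm,
      ENNReal.mul_div_cancel_right (by simpa using hp1) (by simp)]
  calc _ = _ := h1
    _ ≤ ENNReal.ofReal p * (2 * (ENNReal.ofReal (2 ^ (p - 1) / (p - 1)) *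
          ∫⁻ ω, ENNReal.ofReal (X ω ^ p) ∂P)) := by rw [← h5]; gcongr
    _ = _ := by
      rw [show (2 : ℝ≥0∞) = ENNReal.ofReal 2 by simp, ← mul_assoc, ← mul_assoc,
        ← ENNReal.ofReal_mul (by positivity), ← ENNReal.ofReal_mul (by positivity)]
      congr 2
      rw [Real.rpow_sub_one two_ne_zero]; field_simp

/-! ### Cairoli's inequality for commuting filtrations -/

/-- For a commuting filtration the martingale property extends to incomparable times; the passage
from bounded to integrable variables is by truncation. -/
theorem condExp_ae_eq_inf {Ω : Type*} {m : MeasurableSpace Ω} {P : Measure Ω}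
    [IsProbabilityMeasure P] {d : ℕ} {ℱ : Filtration (Fin d → ℝ≥0) m} (hℱ : IsCommuting ℱ P)
    {M : (Fin d → ℝ≥0) → Ω → ℝ} (hM : Martingale M ℱ P) (s t : Fin d → ℝ≥0) :
    P[M t | ℱ s] =ᵐ[P] M (s ⊓ t) := by
  have hMt := hM.integrable t
  have hmeas : Measurable[ℱ t] (M t) := (hM.stronglyMeasurable t).measurable
  set Y : ℕ → Ω → ℝ := fun K ω => max (-(K : ℝ)) (min (M t ω) K) with hY
  have hYmeas : ∀ K, Measurable[ℱ t] (Y K) := fun K =>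
    measurable_const.max (hmeas.min measurable_const)
  have hYb : ∀ K ω, |Y K ω| ≤ K := fun K ω =>
    abs_le.2 ⟨le_max_left _ _, max_le (by linarith [K.cast_nonneg (α := ℝ)]) (min_le_right _ _)⟩
  have hYM : ∀ K ω, ‖Y K ω‖ ≤ |M t ω| := by
    intro K ω
    have hK : (0 : ℝ) ≤ K := K.cast_nonneg
    rw [Real.norm_eq_abs, abs_le]
    constructor
    · refine le_max_of_le_right (le_min (neg_abs_le _) ?_)
      linarith [abs_nonneg (M t ω)]
    · exact max_le (by linarith [abs_nonneg (M t ω)]) ((min_le_left _ _).trans (le_abs_self _))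
  have hlim : ∀ ω, Tendsto (fun K => Y K ω) atTop (𝓝 (M t ω)) := by
    intro ω
    refine tendsto_atTop_of_eventually_const (i₀ := ⌈|M t ω|⌉₊) fun K hK => ?_
    have h := (Nat.le_ceil |M t ω|).trans (Nat.cast_le.2 hK)
    obtain ⟨h1, h2⟩ := abs_le.1 h
    simp only [hY, min_eq_left h2, max_eq_right h1]
  have hYi : ∀ K, Integrable (Y K) P := fun K =>
    hMt.abs.mono' ((hYmeas K).mono (ℱ.le t) le_rfl).aestronglyMeasurable (.of_forall (hYM K))
  have hconv : ∀ r, Tendsto (fun K => condExpL1 (ℱ.le r) P (Y K)) atTop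
      (𝓝 (condExpL1 (ℱ.le r) P (M t))) := fun r =>
    tendsto_condExpL1_of_dominated_convergence (ℱ.le r) _ (fun K => (hYi K).1) hMt.abs
      (fun K => .of_forall (hYM K)) (.of_forall hlim)
  have heq : ∀ K, condExpL1 (ℱ.le s) P (Y K) = condExpL1 (ℱ.le (s ⊓ t)) P (Y K) := fun K =>
    Lp.ext ((condExp_ae_eq_condExpL1 (ℱ.le s) _).symm.trans
      ((hℱ s t (Y K) (hYmeas K) ⟨K, hYb K⟩).trans (condExp_ae_eq_condExpL1 _ _)))
  have hcomm : P[M t | ℱ s] =ᵐ[P] P[M t | ℱ (s ⊓ t)] := by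
    refine (condExp_ae_eq_condExpL1 (ℱ.le s) _).trans
      (EventuallyEq.trans ?_ (condExp_ae_eq_condExpL1 (ℱ.le (s ⊓ t)) _).symm)
    rw [tendsto_nhds_unique (hconv s) ((hconv (s ⊓ t)).congr fun K => (heq K).symm)]
  exact hcomm.trans (hM.2 _ _ inf_le_right)

/-- The point of a finite grid whose coordinates in `S` are `τ (k i)` and whose other coordinates
sit at the horizon `N`. -/
def gridPoint {d : ℕ} (τ : ℕ → ℝ≥0) (N : ℝ≥0) (S : Finset (Fin d)) (k : Fin d → ℕ) :
    Fin d → ℝ≥0 :=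
  fun i => if i ∈ S then τ (k i) else N

theorem gridIndices_nonempty (d n : ℕ) :
    (Fintype.piFinset fun _ : Fin d => Finset.range (n + 1)).Nonempty :=
  ⟨0, by simp⟩

/-- The maximum of `|M|` over the grid points in which the coordinates in `S` run through
`τ 0, …, τ n`. -/
def gridSup {Ω : Type*} {d : ℕ} (M : (Fin d → ℝ≥0) → Ω → ℝ) (τ : ℕ → ℝ≥0) (N : ℝ≥0) (n : ℕ)
    (S : Finset (Fin d)) (ω : Ω) : ℝ :=
  (Fintype.piFinset fun _ : Fin d => Finset.range (n + 1)).sup' (gridIndices_nonempty d n)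
    fun k => |M (gridPoint τ N S k) ω|

theorem gridSup_nonneg {Ω : Type*} {d : ℕ} (M : (Fin d → ℝ≥0) → Ω → ℝ) (τ : ℕ → ℝ≥0) (N : ℝ≥0)
    (n : ℕ) (S : Finset (Fin d)) : 0 ≤ gridSup M τ N n S := fun ω =>
  (abs_nonneg (M (gridPoint τ N S 0) ω)).trans
    (Finset.le_sup' (fun k => |M (gridPoint τ N S k) ω|) (by simp))

theorem abs_le_gridSup {Ω : Type*} {d : ℕ} (M : (Fin d → ℝ≥0) → Ω → ℝ) (τ : ℕ → ℝ≥0) (N : ℝ≥0)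
    {n : ℕ} (S : Finset (Fin d)) {k : Fin d → ℕ} (hk : ∀ i, k i ≤ n) (ω : Ω) :
    |M (gridPoint τ N S k) ω| ≤ gridSup M τ N n S ω :=
  Finset.le_sup' (fun k => |M (gridPoint τ N S k) ω|)
    (by simpa [Fintype.mem_piFinset, Nat.lt_succ_iff] using hk)

theorem measurable_gridSup {Ω : Type*} [MeasurableSpace Ω] {d : ℕ} {M : (Fin d → ℝ≥0) → Ω → ℝ}
    (hM : ∀ t, Measurable (M t)) (τ : ℕ → ℝ≥0) (N : ℝ≥0) (n : ℕ) (S : Finset (Fin d)) :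
    Measurable (gridSup M τ N n S) := by
  have := Finset.measurable_sup' (gridIndices_nonempty d n)
    (f := fun k ω => |M (gridPoint τ N S k) ω|) (fun k _ => (hM _).abs)
  convert this using 1
  ext ω
  simp [gridSup, Finset.sup'_apply]

theorem integrable_gridSup {Ω : Type*} [MeasurableSpace Ω] {P : Measure Ω} {d : ℕ}
    {M : (Fin d → ℝ≥0) → Ω → ℝ} (hM : ∀ t, Measurable (M t)) (hMi : ∀ t, Integrable (M t) P)
    (τ : ℕ → ℝ≥0) (N : ℝ≥0) (n : ℕ) (S : Finset (Fin d)) :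
    Integrable (gridSup M τ N n S) P := by
  have hsum : Integrable (fun ω => ∑ k ∈ Fintype.piFinset fun _ : Fin d => Finset.range (n + 1),
      |M (gridPoint τ N S k) ω|) P :=
    integrable_finsetSum _ fun k _ => (hMi _).abs
  refine hsum.mono' (measurable_gridSup hM τ N n S).aestronglyMeasurable (.of_forall fun ω => ?_)
  rw [Real.norm_of_nonneg (gridSup_nonneg M τ N n S ω)]
  exact Finset.sup'_le _ _ fun k hk =>
    Finset.single_le_sum (f := fun k => |M (gridPoint τ N S k) ω|)
      (fun k _ => abs_nonneg _) hk

/-- Letting one more coordinate run costs one application of Doob's inequality: by commutation the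
values of `M` with `i`-th coordinate `τ r` are conditional expectations of those with `i`-th
coordinate `N`, given a `σ`-field which depends on `r` only. -/
theorem lintegral_gridSup_insert_le {Ω : Type*} {m : MeasurableSpace Ω} {P : Measure Ω}
    [IsProbabilityMeasure P] {d : ℕ} {ℱ : Filtration (Fin d → ℝ≥0) m} (hℱ : IsCommuting ℱ P)
    {M : (Fin d → ℝ≥0) → Ω → ℝ} (hM : Martingale M ℱ P) {p : ℝ} (hp : 1 < p)
    {τ : ℕ → ℝ≥0} (hτ : Monotone τ) {N : ℝ≥0} (hτN : ∀ r, τ r ≤ N) (n : ℕ)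
    {S : Finset (Fin d)} {i : Fin d} (hi : i ∉ S) :
    ∫⁻ ω, ENNReal.ofReal (gridSup M τ N n (insert i S) ω ^ p) ∂P ≤
      ENNReal.ofReal (p * 2 ^ p / (p - 1)) *
        ∫⁻ ω, ENNReal.ofReal (gridSup M τ N n S ω ^ p) ∂P := by
  classical
  have hMm : ∀ t, Measurable (M t) := fun t =>
    (hM.stronglyMeasurable t).measurable.mono (ℱ.le t) le_rfl
  set X := gridSup M τ N n S with hX
  have hXi : Integrable X P := integrable_gridSup hMm hM.integrable τ N n S
  let 𝒢 : Filtration ℕ m :=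
    { seq := fun r => ℱ (Function.update (fun _ => N) i (τ r))
      mono' := fun a b hab => ℱ.mono (update_le_update_iff.2 ⟨hτ hab, fun _ _ => le_rfl⟩)
      le' := fun r => ℱ.le _ }
  have hpt : ∀ k : Fin d → ℕ, Function.update (fun _ => N) i (τ (k i)) ⊓ gridPoint τ N S k =
      gridPoint τ N (insert i S) k := by
    intro k
    ext j
    by_cases hj : j = i
    · subst hj
      simp [gridPoint, hi, hτN]
    · by_cases hjS : j ∈ S <;> simp [gridPoint, hj, hjS, hτN]
  have hdom : ∀ k ∈ Fintype.piFinset fun _ : Fin d => Finset.range (n + 1),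
      ∀ᵐ ω ∂P, |M (gridPoint τ N (insert i S) k) ω| ≤ (P[X | 𝒢 (k i)]) ω := by
    intro k hk
    have hk' : ∀ j, k j ≤ n := by simpa [Fintype.mem_piFinset, Nat.lt_succ_iff] using hk
    have h1 : P[M (gridPoint τ N S k) | 𝒢 (k i)] =ᵐ[P] M (gridPoint τ N (insert i S) k) := by
      rw [← hpt k]; exact condExp_ae_eq_inf hℱ hM _ _
    have h2 : P[M (gridPoint τ N S k) | 𝒢 (k i)] ≤ᵐ[P] P[X | 𝒢 (k i)] :=
      condExp_mono (hM.integrable _) hXi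
        (.of_forall fun ω => (le_abs_self _).trans (abs_le_gridSup M τ N S hk' ω))
    have h3 : P[-M (gridPoint τ N S k) | 𝒢 (k i)] ≤ᵐ[P] P[X | 𝒢 (k i)] :=
      condExp_mono (hM.integrable _).neg hXi
        (.of_forall fun ω => (neg_le_abs _).trans (abs_le_gridSup M τ N S hk' ω))
    filter_upwards [h1, h2, h3, condExp_neg (μ := P) (M (gridPoint τ N S k)) (𝒢 (k i))]
      with ω h1 h2 h3 h4
    rw [h4, Pi.neg_apply, h1] at h3
    rw [h1] at h2
    exact abs_le'.2 ⟨h2, h3⟩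
  have hdom' := (Finset.eventually_all _).2 hdom
  refine le_trans (lintegral_mono_ae ?_) (lintegral_sup_condExp_rpow_le 𝒢 hXi
    (gridSup_nonneg M τ N n S) (measurable_gridSup hMm τ N n S) n hp)
  filter_upwards [hdom'] with ω hω
  refine ENNReal.ofReal_le_ofReal (Real.rpow_le_rpow (gridSup_nonneg M τ N n _ ω) ?_ (by linarith))
  refine Finset.sup'_le _ _ fun k hk => (hω k hk).trans ?_
  exact Finset.le_sup' (fun r => (P[X | 𝒢 r]) ω) (Fintype.mem_piFinset.1 hk i)

/-- **Cairoli's inequality** on a finite grid. -/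
theorem lintegral_gridSup_le {Ω : Type*} {m : MeasurableSpace Ω} {P : Measure Ω}
    [IsProbabilityMeasure P] {d : ℕ} {ℱ : Filtration (Fin d → ℝ≥0) m} (hℱ : IsCommuting ℱ P)
    {M : (Fin d → ℝ≥0) → Ω → ℝ} (hM : Martingale M ℱ P) {p : ℝ} (hp : 1 < p)
    {τ : ℕ → ℝ≥0} (hτ : Monotone τ) {N : ℝ≥0} (hτN : ∀ r, τ r ≤ N) (n : ℕ)
    (S : Finset (Fin d)) :
    ∫⁻ ω, ENNReal.ofReal (gridSup M τ N n S ω ^ p) ∂P ≤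
      ENNReal.ofReal (p * 2 ^ p / (p - 1)) ^ S.card *
        ∫⁻ ω, ENNReal.ofReal (|M (fun _ => N) ω| ^ p) ∂P := by
  classical
  induction S using Finset.induction_on with
  | empty =>
    rw [Finset.card_empty, pow_zero, one_mul]
    refine lintegral_mono fun ω => ENNReal.ofReal_le_ofReal
      (Real.rpow_le_rpow (gridSup_nonneg M τ N n _ ω) ?_ (by linarith))
    refine Finset.sup'_le _ _ fun k _ => le_of_eq ?_
    have : gridPoint τ N ∅ k = fun _ => N := by ext; simp [gridPoint]
    rw [this]
  | insert i S hi ih =>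
    rw [Finset.card_insert_of_notMem hi, pow_succ', mul_assoc]
    exact (lintegral_gridSup_insert_le hℱ hM hp hτ hτN n hi).trans (by gcongr)

/-! ### Polynomial growth of the paths -/

theorem IsLamp.tendsto_of_le {d : ℕ} {f : (Fin d → ℝ≥0) → ℝ} (hf : IsLamp f)
    {u : ℕ → Fin d → ℝ≥0} {t : Fin d → ℝ≥0} (hu : ∀ n, t ≤ u n) (hlim : Tendsto u atTop (𝓝 t)) :
    Tendsto (fun n => f (u n)) atTop (𝓝 (f t)) :=
  (hf.right_continuous t).comp (tendsto_nhdsWithin_iff.2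
    ⟨hlim, .of_forall fun n i => by simpa using hu n i⟩)

/-- The least multiple of `1 / (n + 1)` that is strictly greater than `x`. -/
noncomputable def upperApprox (n : ℕ) (x : ℝ≥0) : ℝ≥0 := ((⌊x * (n + 1)⌋₊ + 1 : ℕ) : ℝ≥0) / (n + 1)

theorem le_upperApprox (n : ℕ) (x : ℝ≥0) : x ≤ upperApprox n x := by
  rw [upperApprox, le_div_iff₀ (by positivity)]
  exact_mod_cast (Nat.lt_floor_add_one (x * (n + 1))).le

theorem upperApprox_le (n : ℕ) (x : ℝ≥0) : upperApprox n x ≤ x + 1 / (n + 1) := by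
  rw [upperApprox, div_le_iff₀ (by positivity), add_mul, one_div_mul_cancel (by positivity)]
  push_cast
  gcongr
  exact Nat.floor_le (by positivity)

theorem tendsto_upperApprox (x : ℝ≥0) : Tendsto (fun n => upperApprox n x) atTop (𝓝 x) := by
  refine tendsto_of_tendsto_of_tendsto_of_le_of_le tendsto_const_nhds ?_
    (fun n => le_upperApprox n x) (fun n => upperApprox_le n x)
  have : Tendsto (fun n : ℕ => 1 / ((n : ℝ≥0) + 1)) atTop (𝓝 0) :=
    tendsto_one_div_add_atTop_nhds_zero_nat
  simpa using tendsto_const_nhds (x := x).add this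

/-- Discretization of time with mesh `1 / (n + 1)`, capped at the horizon `N`. -/
noncomputable def gridTime (N n r : ℕ) : ℝ≥0 := min ((r : ℝ≥0) / (n + 1)) N

theorem monotone_gridTime (N n : ℕ) : Monotone (gridTime N n) := fun a b h =>
  min_le_min_right _ (by gcongr)

/-- Grid maxima over finer and finer grids of the box `[0, N]ᵈ` bound a lamp path, by right
continuity. -/
theorem ofReal_abs_rpow_le_liminf {Ω : Type*} {d : ℕ} {M : (Fin d → ℝ≥0) → Ω → ℝ} {ω : Ω}
    (hf : IsLamp fun t => M t ω) {p : ℝ} (hp : 0 < p) (N : ℕ) {t : Fin d → ℝ≥0}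
    (ht : ∀ i, t i ≤ N) :
    ENNReal.ofReal (|M t ω| ^ p) ≤ liminf (fun n : ℕ => ENNReal.ofReal
      (gridSup M (gridTime N n) N (N * (n + 1) + 1) Finset.univ ω ^ p)) atTop := by
  set u : ℕ → Fin d → ℝ≥0 := fun n =>
    gridPoint (gridTime N n) N Finset.univ fun i => ⌊t i * (n + 1)⌋₊ + 1 with hu
  have hu' : ∀ n i, u n i = min (upperApprox n (t i)) N := by
    intro n i
    simp [hu, gridPoint, gridTime, upperApprox]
  have hle : ∀ n, t ≤ u n := fun n i => by
    rw [hu']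
    exact le_min (le_upperApprox n _) (ht i)
  have hlim : Tendsto u atTop (𝓝 t) := by
    refine tendsto_pi_nhds.2 fun i => ?_
    simp only [hu']
    have := (tendsto_upperApprox (t i)).min (tendsto_const_nhds (x := (N : ℝ≥0)))
    rwa [min_eq_left (ht i)] at this
  have hM : Tendsto (fun n => ENNReal.ofReal (|M (u n) ω| ^ p)) atTop
      (𝓝 (ENNReal.ofReal (|M t ω| ^ p))) :=
    ENNReal.tendsto_ofReal ((hf.tendsto_of_le hle hlim).abs.rpow_const (Or.inr hp.le))
  rw [← hM.liminf_eq]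
  refine liminf_le_liminf (.of_forall fun n => ENNReal.ofReal_le_ofReal
    (Real.rpow_le_rpow (abs_nonneg _) (abs_le_gridSup M _ _ _ (fun i => ?_) ω) hp.le))
  -- The index of the strict upper approximation can be `N * (n + 1) + 1`, when `t i = N`.
  have : t i * (n + 1) ≤ ((N * (n + 1) : ℕ) : ℝ≥0) := by
    push_cast
    gcongr
    exact ht i
  exact Nat.succ_le_succ (Nat.floor_le_of_le this)

/-- Polynomially growing expectations give almost surely polynomial growth, because the normalized
variables have a summable expectation. -/
theorem ae_exists_le_of_lintegral_le {Ω : Type*} [MeasurableSpace Ω] {P : Measure Ω}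
    {Z : ℕ → Ω → ℝ≥0∞} (hZ : ∀ N, Measurable (Z N)) {A e : ℝ}
    (hA : 0 ≤ A) (h : ∀ N : ℕ, ∫⁻ ω, Z N ω ∂P ≤ ENNReal.ofReal (A * ((N : ℝ) + 1) ^ e)) :
    ∀ᵐ ω ∂P, ∃ C : ℝ, 0 ≤ C ∧
      ∀ N : ℕ, Z N ω ≤ ENNReal.ofReal (C * ((N : ℝ) + 1) ^ (e + 2)) := by
  have hpos : ∀ N : ℕ, (0 : ℝ) < (N : ℝ) + 1 := fun N => by positivity
  have hsum : Summable fun N : ℕ => A * ((N : ℝ) + 1) ^ (-2 : ℝ) := by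
    have h1 : Summable fun N : ℕ => (N : ℝ) ^ (-2 : ℝ) := Real.summable_nat_rpow.2 (by norm_num)
    have h2 := (summable_nat_add_iff 1).2 h1
    simpa using h2.mul_left A
  have hint : ∫⁻ ω, ∑' N : ℕ, Z N ω * ENNReal.ofReal (((N : ℝ) + 1) ^ (-(e + 2))) ∂P ≠ ∞ := by
    rw [lintegral_tsum fun N => ((hZ N).mul_const _).aemeasurable]
    refine ne_top_of_le_ne_top hsum.tsum_ofReal_ne_top (ENNReal.tsum_le_tsum fun N => ?_)
    rw [lintegral_mul_const _ (hZ N)]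
    calc _ ≤ ENNReal.ofReal (A * ((N : ℝ) + 1) ^ e) *
          ENNReal.ofReal (((N : ℝ) + 1) ^ (-(e + 2))) := by gcongr; exact h N
      _ = _ := by
        rw [← ENNReal.ofReal_mul (mul_nonneg hA (Real.rpow_nonneg (hpos N).le _)), mul_assoc,
          ← Real.rpow_add (hpos N)]
        congr 3
        ring
  have hae := ae_lt_top (.tsum fun N => (hZ N).mul_const _) hint
  filter_upwards [hae] with ω hω
  refine ⟨(∑' N : ℕ, Z N ω * ENNReal.ofReal (((N : ℝ) + 1) ^ (-(e + 2)))).toReal,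
    ENNReal.toReal_nonneg, fun N => ?_⟩
  rw [ENNReal.ofReal_mul ENNReal.toReal_nonneg, ENNReal.ofReal_toReal hω.ne]
  refine le_trans (le_of_eq ?_) (mul_le_mul_left (ENNReal.le_tsum N) _)
  rw [mul_assoc, ← ENNReal.ofReal_mul (Real.rpow_nonneg (hpos N).le _), ← Real.rpow_add (hpos N)]
  simp

theorem lebBox_const {d : ℕ} (a : ℝ≥0) : lebBox (fun _ : Fin d => a) = (a : ℝ) ^ d := by
  have h := Real.volume_Icc_pi_toReal (a := (0 : Fin d → ℝ)) (b := fun _ => (a : ℝ)) fun _ => a.2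
  simpa [lebBox] using h

theorem le_norm_toEuclidean {d : ℕ} (t : Fin d → ℝ≥0) (i : Fin d) : (t i : ℝ) ≤ ‖toEuclidean t‖ :=
  (le_abs_self _).trans (PiLp.norm_apply_le (toEuclidean t) i)

theorem isSlowlyGrowing_of_box_bound {d : ℕ} {f : (Fin d → ℝ≥0) → ℝ} {p C b : ℝ} (hp : 0 < p)
    (hC : 0 ≤ C) (hb : 0 ≤ b) (h : ∀ (N : ℕ) (t : Fin d → ℝ≥0), (∀ i, t i ≤ ((N + 1 : ℕ) : ℝ≥0)) →
      |f t| ^ p ≤ C * ((N : ℝ) + 1) ^ b) : IsSlowlyGrowing f := by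
  refine ⟨b / p, by positivity, (C * 2 ^ b) ^ (1 / p), fun t => ?_⟩
  set r := ‖toEuclidean t‖
  have hr : 0 ≤ r := norm_nonneg _
  have h1 : |f t| ^ p ≤ C * 2 ^ b * (1 + r) ^ b := by
    refine (h ⌈r⌉₊ t fun i => ?_).trans ?_
    · have := (le_norm_toEuclidean t i).trans (Nat.le_ceil r)
      have h2 : (t i : ℝ) ≤ ((⌈r⌉₊ + 1 : ℕ) : ℝ) := by push_cast; linarith
      exact_mod_cast h2
    · rw [mul_assoc, ← Real.mul_rpow zero_le_two (by positivity)]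
      gcongr
      linarith [Nat.ceil_lt_add_one hr]
  have h2 := Real.rpow_le_rpow (by positivity) h1 (one_div_nonneg.2 hp.le)
  rw [← Real.rpow_mul (abs_nonneg _), mul_one_div_cancel hp.ne', Real.rpow_one,
    Real.mul_rpow (by positivity) (by positivity), ← Real.rpow_mul (by positivity),
    mul_one_div] at h2
  exact h2

/-- Cairoli's inequality on the boxes `[0, N]ᵈ`, together with the moment bound at their upper
corners, makes almost all paths polynomially bounded. -/
theorem ae_isSlowlyGrowing {Ω : Type*} {m : MeasurableSpace Ω} {P : Measure Ω}
    [IsProbabilityMeasure P] {d : ℕ} {p : ℝ} (hp : 1 < p) {ℱ : Filtration (Fin d → ℝ≥0) m}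
    (hℱ : IsCommuting ℱ P) {M : (Fin d → ℝ≥0) → Ω → ℝ} (hM : Martingale M ℱ P)
    (hlamp : ∀ᵐ ω ∂P, IsLamp (fun t => M t ω)) {c : ℝ} (hc : 0 ≤ c)
    (hmoment : ∀ t : Fin d → ℝ≥0, ∫⁻ ω, ENNReal.ofReal (|M t ω| ^ p) ∂P =
      ENNReal.ofReal ((c * lebBox t) ^ (p / 2))) :
    ∀ᵐ ω ∂P, IsSlowlyGrowing (fun t => M t ω) := by
  have hp0 : 0 < p := by linarith
  have hMm : ∀ t, Measurable (M t) := fun t =>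
    (hM.stronglyMeasurable t).measurable.mono (ℱ.le t) le_rfl
  set Z : ℕ → Ω → ℝ≥0∞ := fun N ω => liminf (fun n : ℕ => ENNReal.ofReal
    (gridSup M (gridTime (N + 1) n) (N + 1 : ℕ) ((N + 1) * (n + 1) + 1) Finset.univ ω ^ p)) atTop
    with hZ
  have hgm : ∀ N n : ℕ, Measurable fun ω => ENNReal.ofReal
      (gridSup M (gridTime N n) N (N * (n + 1) + 1) Finset.univ ω ^ p) := fun N n =>
    ((measurable_gridSup hMm _ _ _ _).pow_const p).ennreal_ofReal
  have hZm : ∀ N, Measurable (Z N) := fun N => .liminf fun n => hgm (N + 1) n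
  set K := p * 2 ^ p / (p - 1) with hK
  have hK0 : 0 ≤ K := div_nonneg (by positivity) (by linarith)
  have hZi : ∀ N : ℕ, ∫⁻ ω, Z N ω ∂P ≤
      ENNReal.ofReal (K ^ d * c ^ (p / 2) * ((N : ℝ) + 1) ^ (d * (p / 2))) := by
    intro N
    refine (lintegral_liminf_le fun n => hgm (N + 1) n).trans
      (liminf_le_of_le (by isBoundedDefault) fun a ha => ?_)
    obtain ⟨n, hn⟩ := ha.exists
    refine hn.trans ((lintegral_gridSup_le hℱ hM hp (monotone_gridTime _ n)
      (fun r => min_le_right _ _) _ _).trans (le_of_eq ?_))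
    rw [hmoment, lebBox_const, Finset.card_univ, Fintype.card_fin, ← ENNReal.ofReal_pow hK0,
      ← ENNReal.ofReal_mul (by positivity), Real.mul_rpow hc (by positivity), mul_assoc,
      ← Real.rpow_natCast_mul (by positivity)]
    push_cast
    rfl
  filter_upwards [hlamp, ae_exists_le_of_lintegral_le hZm (by positivity) hZi] with ω hω ⟨C, hC, hCZ⟩
  refine isSlowlyGrowing_of_box_bound (p := p) (b := d * (p / 2) + 2) hp0 hC (by positivity)
    fun N t ht => ?_
  have h1 := (ofReal_abs_rpow_le_liminf hω hp0 (N + 1) ht).trans (hCZ N)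
  exact (ENNReal.ofReal_le_ofReal_iff (by positivity)).1 h1

/-! ### Measurability and temperedness -/

/-- A lamp function is the pointwise limit of its values at the upper grid approximations, which
take countably many values. -/
theorem IsLamp.measurable {d : ℕ} {f : (Fin d → ℝ≥0) → ℝ} (hf : IsLamp f) : Measurable f := by
  refine measurable_of_tendsto_metrizable (f := fun n t => f fun i => upperApprox n (t i))
    (fun n => ?_) (tendsto_pi_nhds.2 fun t => ?_)
  · have h1 : Measurable fun t : Fin d → ℝ≥0 => fun i => ⌊t i * (n + 1)⌋₊ :=
      measurable_pi_lambda _ fun i =>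
        Nat.measurable_floor.comp ((measurable_pi_apply i).mul_const _)
    exact (Measurable.of_discrete (f := fun k : Fin d → ℕ =>
      f fun i => ((k i + 1 : ℕ) : ℝ≥0) / (n + 1))).comp (h1)
  · exact hf.tendsto_of_le (fun n i => le_upperApprox n (t i))
      (tendsto_pi_nhds.2 fun i => tendsto_upperApprox (t i))

/-- A measurable function of polynomial growth is a tempered distribution: on Schwartz functions
`(1 + |x|) ^ (k + d + 1)` is controlled by finitely many seminorms, and `(1 + |x|) ^ (-(d + 1))` is
integrable. -/
theorem IsSlowlyGrowing.isTempered {d : ℕ} {f : (Fin d → ℝ≥0) → ℝ} (hf : IsSlowlyGrowing f)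
    (hfm : Measurable f) : IsTempered f := by
  obtain ⟨α, hα, C, hC⟩ := hf
  let D : Set (EuclideanSpace ℝ (Fin d)) := {x | ∀ i, 0 ≤ x i}
  let g : EuclideanSpace ℝ (Fin d) → ℝ := fun x => f fun i => (x i).toNNReal
  have hDm : MeasurableSet D := by
    have : D = ⋂ i, {x : EuclideanSpace ℝ (Fin d) | 0 ≤ x i} := by ext; simp [D]
    rw [this]
    exact .iInter fun i => measurableSet_le measurable_const (by fun_prop)
  have hgm : Measurable g := hfm.comp (measurable_pi_lambda _ fun i => by fun_prop)
  have hC0 : 0 ≤ C := by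
    have h := (abs_nonneg _).trans (hC 0)
    exact nonneg_of_mul_nonneg_left h (by positivity)
  obtain ⟨k, hk⟩ := exists_nat_ge α
  have hg : ∀ x ∈ D, |g x| ≤ C * (1 + ‖x‖) ^ k := by
    intro x hx
    have hx' : toEuclidean (fun i => (x i).toNNReal) = x := by
      ext i
      simp [toEuclidean, hx i]
    refine (hC fun i => (x i).toNNReal).trans ?_
    rw [hx', ← Real.rpow_natCast]
    gcongr
    linarith [norm_nonneg x]
  let q : Seminorm ℝ 𝓢(EuclideanSpace ℝ (Fin d), ℝ) :=
    (Finset.Iic (k + (d + 1), 0)).sup (schwartzSeminormFamily ℝ (EuclideanSpace ℝ (Fin d)) ℝ)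
  let J : EuclideanSpace ℝ (Fin d) → ℝ := fun x => (1 + ‖x‖) ^ (-((d + 1 : ℕ) : ℝ))
  have hJ : Integrable J := integrable_one_add_norm (by simp)
  have hbound : ∀ φ : 𝓢(EuclideanSpace ℝ (Fin d), ℝ), ∀ x ∈ D,
      ‖g x * φ x‖ ≤ C * (2 ^ (k + (d + 1)) * q φ) * J x := by
    intro φ x hx
    have h1 := SchwartzMap.one_add_le_sup_seminorm_apply (𝕜 := ℝ) (m := (k + (d + 1), 0))
      le_rfl le_rfl φ x
    rw [norm_iteratedFDeriv_zero, pow_add] at h1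
    have hpos : 0 < (1 + ‖x‖) ^ (d + 1) := by positivity
    have h2 : (1 + ‖x‖) ^ k * ‖φ x‖ ≤ 2 ^ (k + (d + 1)) * q φ * J x := by
      simp only [J]
      rw [Real.rpow_neg (by positivity), Real.rpow_natCast, ← div_eq_mul_inv, le_div_iff₀ hpos]
      calc _ = (1 + ‖x‖) ^ k * (1 + ‖x‖) ^ (d + 1) * ‖φ x‖ := by ring
        _ ≤ _ := h1
    rw [norm_mul, Real.norm_eq_abs (g x)]
    calc |g x| * ‖φ x‖ ≤ C * (1 + ‖x‖) ^ k * ‖φ x‖ := by gcongr; exact hg x hx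
      _ = C * ((1 + ‖x‖) ^ k * ‖φ x‖) := by ring
      _ ≤ C * (2 ^ (k + (d + 1)) * q φ * J x) := by gcongr
      _ = _ := by ring
  have hint : ∀ φ : 𝓢(EuclideanSpace ℝ (Fin d), ℝ), IntegrableOn (fun x => g x * φ x) D := fun φ =>
    (hJ.const_mul _).integrableOn.mono' (hgm.mul φ.continuous.measurable).aestronglyMeasurable
      ((ae_restrict_iff' hDm).2 (.of_forall (hbound φ)))
  refine ⟨hint, SchwartzMap.mkCLMtoNormedSpace (fun φ => ∫ x in D, g x * φ x) (fun φ ψ => ?_)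
    (fun a φ => ?_) ⟨Finset.Iic (k + (d + 1), 0),
      C * 2 ^ (k + (d + 1)) * ∫ x, J x, ?_, fun φ => ?_⟩, fun φ => rfl⟩
  · rw [← integral_add (hint φ) (hint ψ)]
    exact integral_congr_ae (.of_forall fun x => mul_add _ _ _)
  · rw [RingHom.id_apply, ← integral_smul]
    exact integral_congr_ae (.of_forall fun x => mul_left_comm _ _ _)
  · exact mul_nonneg (by positivity) (integral_nonneg fun x => by positivity)
  · calc ‖∫ x in D, g x * φ x‖ ≤ ∫ x in D, C * (2 ^ (k + (d + 1)) * q φ) * J x :=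
          norm_integral_le_of_norm_le (hJ.const_mul _).integrableOn
            ((ae_restrict_iff' hDm).2 (.of_forall (hbound φ)))
      _ ≤ ∫ x, C * (2 ^ (k + (d + 1)) * q φ) * J x :=
          setIntegral_le_integral (hJ.const_mul _) (.of_forall fun x => by positivity)
      _ = _ := by rw [integral_const_mul]; ring

end MultiparameterField

theorem proposition3p6 {Ω : Type*} [m : MeasurableSpace Ω] (P : Measure Ω)
    [IsProbabilityMeasure P] (d : ℕ) (hd : 1 ≤ d) (p : ℝ) (hp : 1 < p)
    (ℱ : Filtration (Fin d → ℝ≥0) m) (hℱ : MultiparameterField.IsCommuting ℱ P)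
    (M : (Fin d → ℝ≥0) → Ω → ℝ) (hM : Martingale M ℱ P)
    (hlamp : ∀ᵐ ω ∂P, MultiparameterField.IsLamp (fun t => M t ω))
    (c : ℝ) (hc : 0 ≤ c)
    (hmoment : ∀ t : Fin d → ℝ≥0,
      ∫⁻ ω, ENNReal.ofReal (|M t ω| ^ p) ∂P =
        ENNReal.ofReal ((c * MultiparameterField.lebBox t) ^ (p / 2))) :
    ∀ᵐ ω ∂P, MultiparameterField.IsSlowlyGrowing (fun t => M t ω) ∧
      MultiparameterField.IsTempered (fun t => M t ω) := by
  filter_upwards [MultiparameterField.ae_isSlowlyGrowing hp hℱ hM hlamp hc hmoment, hlamp]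
    with ω hω hl
  exact ⟨hω, hω.isTempered hl.measurable⟩
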